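/- Let $A$ and $B$ be complex unital Banach algebras such that $A$ is a subalgebra of $B$ containing the unit of $B$ (the norm of $A$ need not be the restriction of that of $B$). Assume that $A$ is inverse closed in $B$, i.e. whenever $a\in A$ is invertible in $B$, then $a^{-1}\in A$; and that $A$ is continuously embedded in $B$, i.e. there is $J>0$ with $\|a\|_B\le J\|a\|_A$ for all $a\in A$. A two-sided ideal of $A$ is called inessential if, for each of its elements $a$, the spectrum $\sigma(a;A)$ of $a$ in $A$ has no accumulation point other than $0$; let $I(A)$ denote the largest inessential ideal of $A$ (the sum of all inessential ideals of $A$). Let $n$ be a natural number and let $T=(t_{jk})\in M_n(A)$ be an $n\times n$ matrix over $A$ such that either $t_{jk}\in I(A)$ whenever $j>k$, or $t_{jk}\in I(A)$ whenever $j<k$. If $T$ is invertible in $M_n(B)$, then $T^{-1}\in M_n(A)$. -/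

import Mathlib

/-- `A` is a complex unital subalgebra of `B`, with a norm of its own: `ι : A →ₐ[ℂ] B` is the
(injective, unit preserving) inclusion. `A` is inverse closed in `B` if the inverse in `B` of an
element of `A`, when there is one, lies in `A`. -/
def InverseClosed {A B : Type*} [Ring A] [Algebra ℂ A] [Ring B] [Algebra ℂ B]
    (ι : A →ₐ[ℂ] B) : Prop :=
  ∀ (a : A) (b : B), ι a * b = 1 → b * ι a = 1 → ∃ c : A, ι c = b

/-- `A` is continuously embedded in `B`: `‖a‖_B ≤ J ‖a‖_A` for some constant `J > 0`. -/
def ContinuouslyEmbedded {A B : Type*} [NormedRing A] [NormedAlgebra ℂ A]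
    [NormedRing B] [NormedAlgebra ℂ B] (ι : A →ₐ[ℂ] B) : Prop :=
  ∃ J : ℝ, 0 < J ∧ ∀ a : A, ‖ι a‖ ≤ J * ‖a‖

/-- A two-sided ideal is inessential if the spectrum (in `A`) of each of its elements has no
accumulation point other than `0`, i.e. is finite or a sequence converging to `0`. -/
def IsInessential {A : Type*} [NormedRing A] [NormedAlgebra ℂ A] (J : TwoSidedIdeal A) : Prop :=
  ∀ a ∈ J, ∀ z : ℂ, AccPt z (Filter.principal (spectrum ℂ a)) → z = 0

/-- The largest inessential ideal `I(A)`, as the supremum (the sum) of all inessential ideals. -/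
noncomputable def largestInessentialIdeal (A : Type*) [NormedRing A] [NormedAlgebra ℂ A] :
    TwoSidedIdeal A :=
  sSup {J : TwoSidedIdeal A | IsInessential J}

/-- The greatest inessential ideal is the supremum of all of them. -/
theorem IsGreatest.eq_largestInessentialIdeal {A : Type*} [NormedRing A] [NormedAlgebra ℂ A]
    {J : TwoSidedIdeal A} (hJ : IsGreatest {J : TwoSidedIdeal A | IsInessential J} J) :
    J = largestInessentialIdeal A :=
  hJ.isLUB.sSup_eq.symm

/-- `U_n^e(A)`: the matrices whose entries below the diagonal lie in `I(A)`. -/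
def essUpperTriangular (n : ℕ) (A : Type*) [NormedRing A] [NormedAlgebra ℂ A] :
    Set (Matrix (Fin n) (Fin n) A) :=
  {T | ∀ j k, k < j → T j k ∈ largestInessentialIdeal A}

/-- `L_n^e(A)`: the matrices whose entries above the diagonal lie in `I(A)`. -/
def essLowerTriangular (n : ℕ) (A : Type*) [NormedRing A] [NormedAlgebra ℂ A] :
    Set (Matrix (Fin n) (Fin n) A) :=
  {T | ∀ j k, j < k → T j k ∈ largestInessentialIdeal A}

/-! ### Inessential ideals and limits of invertible elements -/

open Filter Topology

/-! Every element of `I(A)` is a limit of invertibles of `A`. Invertibility over `B` is an open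
condition, so the entry of `T` at `(1, 0)` can be moved to a nearby unit of `A` without losing it.
Pivoting on that unit leaves a smaller matrix whose entries below the diagonal are still in `I(A)`;
by induction the moved matrix is invertible over `A`. Undoing the move is a rank-one change, whose
effect on invertibility is decided by a single element of `A`, where inverse closedness applies
(`Matrix.isUnit_sub_single_of_isUnit_map`). -/

/-- Every element of an inessential ideal perturbs invertible elements within the closure of the
group of invertible elements. -/
theorem IsInessential.isUnit_add_mem_closure {A : Type*} [NormedRing A] [NormedAlgebra ℂ A]
    {J : TwoSidedIdeal A} (hJ : IsInessential J) {c : A} (hc : c ∈ J) {x : A} (hx : IsUnit x) :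
    x + c ∈ closure {a : A | IsUnit a} := by
  obtain ⟨u, rfl⟩ := hx
  have hd : (↑u⁻¹ * c : A) ∈ J := J.mul_mem_left _ _ hc
  -- As `-1` is not an accumulation point of the spectrum, `u * (u⁻¹ * c - z)` is invertible for `z
  -- ≠ -1` near `-1`, and it tends to `u + c`.
  have hacc : ¬ AccPt (-1 : ℂ) (𝓟 (spectrum ℂ (↑u⁻¹ * c : A))) := fun h => by
    exact neg_ne_zero.mpr one_ne_zero (hJ _ hd _ h)
  have hev : ∀ᶠ z in 𝓝[≠] (-1 : ℂ), z ∉ spectrum ℂ (↑u⁻¹ * c : A) := by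
    rw [accPt_iff_frequently_nhdsNE] at hacc
    exact not_frequently.mp hacc
  have hcont : Continuous fun z : ℂ => (u : A) * (↑u⁻¹ * c - algebraMap ℂ A z) :=
    continuous_const.mul (continuous_const.sub (algebraMapCLM ℂ A).continuous)
  have hlim : Tendsto (fun z : ℂ => (u : A) * (↑u⁻¹ * c - algebraMap ℂ A z)) (𝓝[≠] (-1))
      (𝓝 (u + c)) := by
    have h := (hcont.tendsto (-1)).mono_left (nhdsWithin_le_nhds (s := {-1}ᶜ))
    have he : (u : A) * (↑u⁻¹ * c - algebraMap ℂ A (-1)) = u + c := by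
      simp [mul_add, add_comm]
    rwa [he] at h
  refine mem_closure_of_tendsto hlim (hev.mono fun z hz => ?_)
  rw [spectrum.notMem_iff] at hz
  have h := hz.neg
  rw [neg_sub] at h
  exact u.isUnit.mul h

/-- The elements of the largest inessential ideal are limits of invertible elements. -/
theorem mem_closure_isUnit_of_mem_largestInessentialIdeal {A : Type*} [NormedRing A]
    [NormedAlgebra ℂ A] {c : A} (hc : c ∈ largestInessentialIdeal A) :
    c ∈ closure {a : A | IsUnit a} := by
  -- `H` consists of finite sums of elements of inessential ideals, which permits induction on `c`.
  let H : AddSubgroup A := AddSubgroup.closure {a | ∃ J : TwoSidedIdeal A, IsInessential J ∧ a ∈ J}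
  have hl : ∀ x y : A, y ∈ H → x * y ∈ H := fun x y hy => by
    induction hy using AddSubgroup.closure_induction with
    | mem y hy =>
      obtain ⟨J, hJ, hy⟩ := hy
      exact AddSubgroup.subset_closure ⟨J, hJ, J.mul_mem_left _ _ hy⟩
    | zero => rw [mul_zero]; exact H.zero_mem
    | add y z _ _ h₁ h₂ => rw [mul_add]; exact H.add_mem h₁ h₂
    | neg y _ h => rw [mul_neg]; exact H.neg_mem h
  have hr : ∀ x y : A, x ∈ H → x * y ∈ H := fun x y hx => by
    induction hx using AddSubgroup.closure_induction with
    | mem x hx =>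
      obtain ⟨J, hJ, hx⟩ := hx
      exact AddSubgroup.subset_closure ⟨J, hJ, J.mul_mem_right _ _ hx⟩
    | zero => rw [zero_mul]; exact H.zero_mem
    | add y z _ _ h₁ h₂ => rw [add_mul]; exact H.add_mem h₁ h₂
    | neg y _ h => rw [neg_mul]; exact H.neg_mem h
  let K : TwoSidedIdeal A := TwoSidedIdeal.mk' H H.zero_mem (fun h₁ h₂ => H.add_mem h₁ h₂)
    (fun h => H.neg_mem h) (fun {x y} h => hl x y h) (fun {x y} h => hr x y h)
  have hK : largestInessentialIdeal A ≤ K := by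
    refine sSup_le fun J hJ a ha => ?_
    rw [TwoSidedIdeal.mem_mk']
    exact AddSubgroup.subset_closure ⟨J, hJ, ha⟩
  have hcH : c ∈ H := by
    have h := hK hc
    rwa [TwoSidedIdeal.mem_mk'] at h
  -- Quantifying over the whole closure lets summands be added one at a time; both signs are needed
  -- for the negation case.
  have key : ∀ x ∈ closure {a : A | IsUnit a}, x + c ∈ closure {a : A | IsUnit a} ∧
      x - c ∈ closure {a : A | IsUnit a} := by
    clear hc
    induction hcH using AddSubgroup.closure_induction with
    | mem y hy =>
      obtain ⟨J, hJ, hy⟩ := hy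
      have aux : ∀ d ∈ J, ∀ x ∈ closure {a : A | IsUnit a},
          x + d ∈ closure {a : A | IsUnit a} := fun d hd x hx => by
        have := map_mem_closure (continuous_id.add continuous_const) hx
          (t := closure {a : A | IsUnit a}) (f := fun x => x + d)
          fun x hx => hJ.isUnit_add_mem_closure hd hx
        rwa [closure_closure] at this
      exact fun x hx => ⟨aux y hy x hx, by
        simpa [sub_eq_add_neg] using aux (-y) (J.neg_mem hy) x hx⟩
    | zero => intro x hx; simpa using hx
    | add y z _ _ h₁ h₂ =>
      intro x hx
      rw [← add_assoc, ← sub_sub]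
      exact ⟨(h₂ _ (h₁ x hx).1).1, (h₂ _ (h₁ x hx).2).2⟩
    | neg y _ h =>
      intro x hx
      rw [← sub_eq_add_neg, sub_neg_eq_add]
      exact ⟨(h x hx).2, (h x hx).1⟩
  have hzero : (0 : A) ∈ closure {a : A | IsUnit a} := by
    have hlim : Tendsto (fun z : ℂ => algebraMap ℂ A z) (𝓝[≠] 0) (𝓝 0) := by
      have h := ((algebraMapCLM ℂ A).continuous.tendsto 0).mono_left
        (nhdsWithin_le_nhds (s := {0}ᶜ))
      rw [map_zero] at h
      exact h
    refine mem_closure_of_tendsto hlim ?_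
    filter_upwards [self_mem_nhdsWithin] with z hz
    exact (IsUnit.mk0 z hz).map (algebraMap ℂ A)
  simpa using (key 0 hzero).1

/-! ### Schur complements and pivots over noncommutative rings -/

namespace Matrix

section Ring

variable {R : Type*} [Ring R] {m n : Type*} [Fintype m] [Fintype n] [DecidableEq m]
  [DecidableEq n]

theorem _root_.IsUnit.submatrix_equiv_equiv {M : Matrix n n R} (hM : IsUnit M) (e₁ e₂ : m ≃ n) :
    IsUnit (M.submatrix e₁ e₂) := by
  obtain ⟨u, hu⟩ := hM
  refine ⟨⟨M.submatrix e₁ e₂, (↑u⁻¹ : Matrix n n R).submatrix e₂ e₁, ?_, ?_⟩, rfl⟩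
  · rw [submatrix_mul_equiv, ← hu, u.mul_inv, submatrix_one_equiv]
  · rw [submatrix_mul_equiv, ← hu, u.inv_mul, submatrix_one_equiv]

/-- Invertibility is invariant under independent relabellings of the rows and the columns. -/
theorem isUnit_submatrix_equiv_equiv {M : Matrix n n R} (e₁ e₂ : m ≃ n) :
    IsUnit (M.submatrix e₁ e₂) ↔ IsUnit M := by
  refine ⟨fun h => ?_, fun h => h.submatrix_equiv_equiv e₁ e₂⟩
  simpa [submatrix_submatrix] using h.submatrix_equiv_equiv e₁.symm e₂.symm

theorem isUnit_fromBlocks_zero_zero_iff {X : Matrix m m R} {D : Matrix n n R} (hD : IsUnit D) :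
    IsUnit (fromBlocks X 0 0 D) ↔ IsUnit X := by
  constructor
  · rintro ⟨u, hu⟩
    have h₁ := u.mul_inv
    have h₂ := u.inv_mul
    rw [hu, ← fromBlocks_toBlocks (↑u⁻¹ : Matrix (m ⊕ n) (m ⊕ n) R), fromBlocks_multiply,
      ← fromBlocks_one, fromBlocks_inj] at h₁ h₂
    exact ⟨⟨X, _, by simpa using h₁.1, by simpa using h₂.1⟩, rfl⟩
  · rintro ⟨x, rfl⟩
    obtain ⟨d, rfl⟩ := hD
    exact ⟨⟨fromBlocks x 0 0 d, fromBlocks ↑x⁻¹ 0 0 ↑d⁻¹, by simp [fromBlocks_multiply],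
      by simp [fromBlocks_multiply]⟩, rfl⟩

/-- A block matrix with invertible lower right corner is invertible if and only if its Schur
complement is, over a ring that need not be commutative. -/
theorem isUnit_fromBlocks_iff_isUnit_schurComplement {P : Matrix m m R} {Q : Matrix m n R}
    {L : Matrix n m R} (D : (Matrix n n R)ˣ) :
    IsUnit (fromBlocks P Q L D) ↔ IsUnit (P - Q * (↑D⁻¹ : Matrix n n R) * L) := by
  have hfac : fromBlocks P Q L D =
      fromBlocks 1 (Q * (↑D⁻¹ : Matrix n n R)) 0 1 *
        fromBlocks (P - Q * (↑D⁻¹ : Matrix n n R) * L) 0 0 D *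
        fromBlocks 1 0 ((↑D⁻¹ : Matrix n n R) * L) 1 := by
    have h₁ : (D : Matrix n n R) * ((↑D⁻¹ : Matrix n n R) * L) = L := by
      rw [← Matrix.mul_assoc, D.mul_inv, Matrix.one_mul]
    have h₂ : Q * (↑D⁻¹ : Matrix n n R) * (D : Matrix n n R) = Q := by
      rw [Matrix.mul_assoc, D.inv_mul, Matrix.mul_one]
    simp [fromBlocks_multiply, h₁, h₂, Matrix.mul_assoc]
  have hU : ∀ X : Matrix m n R, IsUnit (fromBlocks (1 : Matrix m m R) X 0 1) := fun X =>
    ⟨⟨fromBlocks (1 : Matrix m m R) X 0 (1 : Matrix n n R),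
      fromBlocks (1 : Matrix m m R) (-X) 0 (1 : Matrix n n R), by simp [fromBlocks_multiply],
      by simp [fromBlocks_multiply]⟩, rfl⟩
  have hL : ∀ X : Matrix n m R, IsUnit (fromBlocks (1 : Matrix m m R) 0 X 1) := fun X =>
    ⟨⟨fromBlocks (1 : Matrix m m R) 0 X (1 : Matrix n n R),
      fromBlocks (1 : Matrix m m R) 0 (-X) (1 : Matrix n n R), by simp [fromBlocks_multiply],
      by simp [fromBlocks_multiply]⟩, rfl⟩
  obtain ⟨u, hu⟩ := hU (Q * (↑D⁻¹ : Matrix n n R))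
  obtain ⟨v, hv⟩ := hL ((↑D⁻¹ : Matrix n n R) * L)
  rw [hfac, ← hu, ← hv, Units.isUnit_mul_units, Units.isUnit_units_mul,
    isUnit_fromBlocks_zero_zero_iff D.isUnit]

/-- Elimination of row `i` and column `j` by means of the invertible entry `M i j`. -/
def pivotComplement {k : ℕ} (M : Matrix (Fin (k + 1)) (Fin (k + 1)) R) (i j : Fin (k + 1))
    (u : Rˣ) : Matrix (Fin k) (Fin k) R :=
  of fun r c => M (i.succAbove r) (j.succAbove c) -
    M (i.succAbove r) j * ↑u⁻¹ * M i (j.succAbove c)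

theorem isUnit_iff_isUnit_pivotComplement {k : ℕ} {M : Matrix (Fin (k + 1)) (Fin (k + 1)) R}
    {i j : Fin (k + 1)} {u : Rˣ} (hu : M i j = u) :
    IsUnit M ↔ IsUnit (M.pivotComplement i j u) := by
  -- `e i` sends the `Unit` summand to `i`, so an off-diagonal pivot becomes the lower right corner.
  let e : Fin (k + 1) → (Fin k ⊕ Unit ≃ Fin (k + 1)) := fun i =>
    (Equiv.optionEquivSumPUnit (Fin k)).symm.trans (finSuccEquiv' i).symm
  let D : (Matrix Unit Unit R)ˣ := Units.map (scalar Unit).toMonoidHom u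
  have hM : M.submatrix (e i) (e j) =
      fromBlocks (of fun r c => M (i.succAbove r) (j.succAbove c))
        (of fun r _ => M (i.succAbove r) j) (of fun _ c => M i (j.succAbove c)) D := by
    ext (r | r) (c | c) <;> simp [e, D, hu]
  rw [← isUnit_submatrix_equiv_equiv (e i) (e j), hM, isUnit_fromBlocks_iff_isUnit_schurComplement]
  have hC : M.pivotComplement i j u = (of fun r c => M (i.succAbove r) (j.succAbove c)) -
      (of fun r (_ : Unit) => M (i.succAbove r) j) * (↑D⁻¹ : Matrix Unit Unit R) *
        (of fun (_ : Unit) c => M i (j.succAbove c)) := by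
    ext r c
    simp [pivotComplement, D, Matrix.mul_apply]
  rw [hC]

/-- Jacobson's lemma: if `N` inverts `1 - X * Y`, then `1 + Y * N * X` inverts `1 - Y * X`. -/
theorem isUnit_one_sub_mul_of_isUnit_one_sub_mul {X : Matrix m n R} {Y : Matrix n m R}
    (h : IsUnit (1 - X * Y)) : IsUnit (1 - Y * X) := by
  obtain ⟨u, hu⟩ := h
  have h₁ := u.mul_inv
  have h₂ := u.inv_mul
  rw [hu] at h₁ h₂
  generalize (↑u⁻¹ : Matrix m m R) = N at h₁ h₂
  refine ⟨⟨1 - Y * X, 1 + Y * N * X, ?_, ?_⟩, rfl⟩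
  · have : (1 - Y * X) * (1 + Y * N * X) = 1 - Y * X + Y * ((1 - X * Y) * N) * X := by
      simp only [Matrix.sub_mul, Matrix.mul_sub, Matrix.mul_add, Matrix.one_mul, Matrix.mul_one,
        Matrix.mul_assoc]
    rw [this, h₁, Matrix.mul_one, sub_add_cancel]
  · have : (1 + Y * N * X) * (1 - Y * X) = 1 - Y * X + Y * (N * (1 - X * Y)) * X := by
      simp only [Matrix.sub_mul, Matrix.mul_sub, Matrix.add_mul, Matrix.one_mul, Matrix.mul_one,
        Matrix.mul_assoc]
      abel
    rw [this, h₂, Matrix.mul_one, sub_add_cancel]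

theorem isUnit_iff_isUnit_apply_default [Unique n] {M : Matrix n n R} :
    IsUnit M ↔ IsUnit (M default default) := by
  constructor
  · rintro ⟨u, rfl⟩
    have h₁ := congrFun₂ u.mul_inv default default
    have h₂ := congrFun₂ u.inv_mul default default
    rw [Matrix.mul_apply, Fintype.sum_unique, one_apply_eq] at h₁ h₂
    exact ⟨⟨_, _, h₁, h₂⟩, rfl⟩
  · rintro ⟨u, hu⟩
    refine ⟨⟨M, of fun _ _ => ↑u⁻¹, ?_, ?_⟩, rfl⟩ <;> ext i j <;>
      rw [Subsingleton.elim i default, Subsingleton.elim j default, Matrix.mul_apply,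
        Fintype.sum_unique, one_apply_eq, of_apply, ← hu]
    · exact u.mul_inv
    · exact u.inv_mul

end Ring

/-! ### Testing invertibility over the larger ring -/

section LocalHom

variable {R S : Type*} [Ring R] [Ring S] (f : R →+* S) [IsLocalHom f]

/-- Invertibility of a matrix over `R` can be tested over `S` if this holds for the entries and the
matrix differs in a single entry from an invertible matrix. -/
theorem isUnit_sub_single_of_isUnit_map {n : Type*} [Fintype n] [DecidableEq n]
    {M : Matrix n n R} (hM : IsUnit M) (i j : n) (v : R)
    (h : IsUnit (f.mapMatrix (M - single i j v))) : IsUnit (M - single i j v) := by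
  obtain ⟨u, rfl⟩ := hM
  -- The perturbation factors through `Unit`, so `1 - Y * X` is a 1×1 matrix.
  let X : Matrix n Unit R := (↑u⁻¹ : Matrix n n R) * single i () v
  let Y : Matrix Unit n R := single () j 1
  have hfac : (u : Matrix n n R) - single i j v = (u : Matrix n n R) * (1 - X * Y) := by
    rw [mul_sub, mul_one, Matrix.mul_assoc, single_mul_single_same, mul_one,
      Units.mul_inv_cancel_left]
  have hmap : f.mapMatrix (1 - X * Y) = 1 - X.map f * Y.map f := by
    rw [map_sub, map_one, RingHom.mapMatrix_apply, Matrix.map_mul]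
  have hmap' : f.mapMatrix (1 - Y * X) = 1 - Y.map f * X.map f := by
    rw [map_sub, map_one, RingHom.mapMatrix_apply, Matrix.map_mul]
  have hS : IsUnit (1 - Y.map f * X.map f) := by
    apply isUnit_one_sub_mul_of_isUnit_one_sub_mul
    rw [← hmap]
    rw [hfac, map_mul] at h
    obtain ⟨w, hw⟩ := u.isUnit.map f.mapMatrix
    rwa [← hw, Units.isUnit_units_mul] at h
  have hR : IsUnit (1 - Y * X) := by
    rw [← hmap', isUnit_iff_isUnit_apply_default] at hS
    exact isUnit_iff_isUnit_apply_default.mpr (IsLocalHom.map_nonunit (f := f) _ hS)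
  rw [hfac]
  exact u.isUnit.mul (isUnit_one_sub_mul_of_isUnit_one_sub_mul hR)

end LocalHom

theorem eventually_isUnit_of_isUnit {R : Type*} [NormedRing R] [CompleteSpace R] {n : Type*}
    [Fintype n] [DecidableEq n] {M : Matrix n n R} (hM : IsUnit M) :
    ∀ᶠ N in 𝓝 M, IsUnit N := by
  have hc : CompleteSpace (Matrix n n R) := inferInstance
  let _ : NormedRing (Matrix n n R) := Matrix.linftyOpNormedRing
  have : @CompleteSpace (Matrix n n R) PseudoMetricSpace.toUniformSpace := hc
  exact Units.isOpen.mem_nhds hM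

/-- If `f : R → S` is a continuous inverse closed embedding of normed rings, then the invertibility
of a matrix over `R` can be tested over `S` as soon as its entries below the diagonal lie in an
ideal consisting of limits of invertible elements. -/
theorem isUnit_of_isUnit_map_of_mem_ideal {R S : Type*} [NormedRing R] [NormedRing S]
    [CompleteSpace S] (f : R →+* S) [IsLocalHom f] (hf : Continuous f) {I : TwoSidedIdeal R}
    (hI : ∀ c ∈ I, c ∈ closure {a : R | IsUnit a}) {n : ℕ} {T : Matrix (Fin n) (Fin n) R}
    (hT : ∀ j k, k < j → T j k ∈ I) (h : IsUnit (f.mapMatrix T)) : IsUnit T := by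
  induction n with
  | zero => exact isUnit_of_subsingleton T
  | succ n ih =>
  obtain _ | n := n
  -- Size one is separate: the pivot `(1, 0)` needs two rows.
  · have : Unique (Fin (0 + 1)) := inferInstanceAs (Unique (Fin 1))
    rw [isUnit_iff_isUnit_apply_default] at h ⊢
    exact IsLocalHom.map_nonunit (f := f) _ h
  have hpert : Continuous fun a : R => f.mapMatrix (T + single 1 0 (a - T 1 0)) := by
    refine continuous_matrix fun r c => ?_
    simp only [RingHom.mapMatrix_apply, map_apply, add_apply, single_apply]
    split_ifs <;> fun_prop
  have hev : ∀ᶠ a in 𝓝 (T 1 0), IsUnit (f.mapMatrix (T + single 1 0 (a - T 1 0))) := by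
    refine (hpert.tendsto (T 1 0)).eventually (eventually_isUnit_of_isUnit ?_)
    simpa using h
  obtain ⟨_, ⟨u, rfl⟩, hu⟩ :=
    ((mem_closure_iff_frequently.mp (hI _ (hT 1 0 (by simp)))).and_eventually hev).exists
  set T' := T + single 1 0 ((u : R) - T 1 0) with hT'
  have hpiv : T' 1 0 = u := by simp [hT']
  have hoff : ∀ r c, r ≠ 1 → T' r c = T r c := fun r c hr => by
    simp [hT', hr.symm]
  have hcomp : f.mapMatrix (T'.pivotComplement 1 0 u) =
      (f.mapMatrix T').pivotComplement 1 0 (Units.map f.toMonoidHom u) := by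
    ext r c
    simp [pivotComplement]
  have hunit : IsUnit T' := by
    rw [isUnit_iff_isUnit_pivotComplement hpiv]
    refine ih (fun r c hrc => ?_) ?_
    -- `c < r` forces `r ≥ 1`, so the row comes from below the deleted row 1, and its entry in
    -- column 0 lies in `I`; hence so does the pivot correction.
    · have hr : (1 : Fin (n + 2)).succAbove r = r.succ :=
        Fin.succAbove_of_le_castSucc _ _ (by
          rw [Fin.le_def]; rw [Fin.lt_def] at hrc; simp; omega)
      have hr1 : r.succ ≠ 1 := by
        rw [← Fin.succ_zero_eq_one, Ne, Fin.succ_inj]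
        exact (c.zero_le.trans_lt hrc).ne'
      simp only [pivotComplement, of_apply, hr, hoff _ _ hr1, Fin.succAbove_zero]
      exact I.sub_mem (hT _ _ (Fin.succ_lt_succ_iff.mpr hrc))
        (I.mul_mem_right _ _ (I.mul_mem_right _ _ (hT _ _ (Fin.succ_pos r))))
    · rw [hcomp, ← isUnit_iff_isUnit_pivotComplement (by simp [hpiv])]
      exact hu
  have hback : T = T' - single 1 0 ((u : R) - T 1 0) := by simp [hT']
  rw [hback] at h ⊢
  exact isUnit_sub_single_of_isUnit_map f hunit 1 0 _ h

end Matrix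

theorem InverseClosed.isLocalHom {A B : Type*} [Ring A] [Algebra ℂ A] [Ring B] [Algebra ℂ B]
    {ι : A →ₐ[ℂ] B} (hinv : InverseClosed ι) (hι : Function.Injective ι) :
    IsLocalHom (ι : A →+* B) := by
  refine ⟨fun a ⟨u, hu⟩ => ?_⟩
  change (u : B) = ι a at hu
  obtain ⟨c, hc⟩ := hinv a ↑u⁻¹ (by rw [← hu, u.mul_inv]) (by rw [← hu, u.inv_mul])
  exact ⟨⟨a, c, hι (by rw [map_mul, hc, ← hu, u.mul_inv, map_one]),
    hι (by rw [map_mul, hc, ← hu, u.inv_mul, map_one])⟩, rfl⟩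

theorem ContinuouslyEmbedded.continuous {A B : Type*} [NormedRing A] [NormedAlgebra ℂ A]
    [NormedRing B] [NormedAlgebra ℂ B] {ι : A →ₐ[ℂ] B} (h : ContinuouslyEmbedded ι) :
    Continuous ι := by
  obtain ⟨J, -, hJ⟩ := h
  exact AddMonoidHomClass.continuous_of_bound ι J hJ

theorem theorem6 {A B : Type*}
    [NormedRing A] [NormedAlgebra ℂ A] [CompleteSpace A]
    [NormedRing B] [NormedAlgebra ℂ B] [CompleteSpace B]
    (ι : A →ₐ[ℂ] B) (hι : Function.Injective ι)
    (hinv : InverseClosed ι) (hemb : ContinuouslyEmbedded ι)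
    (n : ℕ) (T : Matrix (Fin n) (Fin n) A)
    (hT : T ∈ essUpperTriangular n A ∨ T ∈ essLowerTriangular n A)
    (S : Matrix (Fin n) (Fin n) B)
    (hTS : T.map ι * S = 1) (hST : S * T.map ι = 1) :
    ∃ R : Matrix (Fin n) (Fin n) A, R.map ι = S := by
  have := hinv.isLocalHom hι
  have hcont : Continuous (ι : A →+* B) := hemb.continuous
  have hB : IsUnit ((ι : A →+* B).mapMatrix T) := ⟨⟨T.map ι, S, hTS, hST⟩, rfl⟩
  have hA : IsUnit T := by
    rcases hT with hT | hT
    · exact Matrix.isUnit_of_isUnit_map_of_mem_ideal _ hcont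
        (fun _ => mem_closure_isUnit_of_mem_largestInessentialIdeal) hT hB
    -- Reversing the order of rows and columns exchanges the two triangular cases.
    · rw [← Matrix.isUnit_submatrix_equiv_equiv Fin.revPerm Fin.revPerm]
      refine Matrix.isUnit_of_isUnit_map_of_mem_ideal _ hcont
        (fun _ => mem_closure_isUnit_of_mem_largestInessentialIdeal)
        (fun j k hjk => hT _ _ (Fin.rev_lt_rev.mpr hjk)) ?_
      exact hB.submatrix_equiv_equiv Fin.revPerm Fin.revPerm
  obtain ⟨u, rfl⟩ := hA
  refine ⟨↑u⁻¹, left_inv_eq_right_inv ?_ hTS⟩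
  have h := congrArg (ι : A →+* B).mapMatrix u.inv_mul
  rw [map_mul, map_one] at h
  exact h
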